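/- Semigroups are written additively and need not be commutative. For a sequence $a_1,a_2,\dots$ in a semigroup let $\mathrm{FS}(a_1,a_2,\dots)=\{a_{i_1}+\cdots+a_{i_m} : m\ge 1,\ i_1<\cdots<i_m\}$. A *proper IP set* in a semigroup is a subset that contains $\mathrm{FS}(a_1,a_2,\dots)$ for some sequence $a_1,a_2,\dots$ of pairwise distinct elements. A family of sets is *partition regular* if for each finite partition of a set from the family, some part is also in the family. An infinite semigroup $S$ is *moving* if for each infinite $A\subseteq S$ and each finite $F\subseteq S$ there are $a_1,\dots,a_k\in A$ such that $\{a_1+s,\dots,a_k+s\}\not\subseteq F$ for all but finitely many $s\in S$. A semigroup $S$ has *finite-to-one right addition* if for all $s,b\in S$ the set $\{a\in S : a+s=b\}$ is finite. **Corollary.** Let $S$ be the semigroup presented by $$S=\langle\, t,x_0,x_1,x_2,\dots \;:\; x_0+t=x_0,\ \ x_i+t=x_{i-1}\ (i>0)\,\rangle .$$ Then $S$ is infinite, $S$ has finite-to-one right addition, $S$ is not moving, and the family of proper IP sets in $S$ is partition regular. In particular, there is a non-moving infinite semigroup in which the proper IP sets are partition regular, which answers negatively the question of Andrews and Goldbring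 whether partition regularity of the proper IP sets characterizes the moving semigroups. -/

import Mathlib

namespace IPSet

/-- A family of subsets of `α` is partition regular if, for each finite partition of a set from
the family, some part is also in the family. -/
def IsPartitionRegular {α : Type*} (𝓕 : Set (Set α)) : Prop :=
  ∀ A ∈ 𝓕, ∀ (k : ℕ) (P : Fin k → Set α),
    Pairwise (fun i j => Disjoint (P i) (P j)) → (⋃ i, P i) = A → ∃ i, P i ∈ 𝓕

/-- A proper IP set in a (not necessarily commutative) semigroup: a set containing all finite sums
`a i₁ + ⋯ + a iₘ` (`m ≥ 1`, `i₁ < ⋯ < iₘ`) of some sequence `a` of pairwise distinct elements.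
`Hindman.FS a` is the set of these sums, taken in increasing order of the indices. -/
def IsProperIP {S : Type*} [AddSemigroup S] (A : Set S) : Prop :=
  ∃ a : Stream' S, Function.Injective a.get ∧ Hindman.FS a ⊆ A

/-- An infinite semigroup is moving if for each infinite `A` and each finite `F` there are
elements `a₁, …, aₖ` of `A` such that `{a₁ + s, …, aₖ + s} ⊈ F` for all but finitely many `s`. -/
def IsMoving (S : Type*) [AddSemigroup S] : Prop :=
  Infinite S ∧ ∀ A : Set S, A.Infinite → ∀ F : Set S, F.Finite →
    ∃ B : Set S, B.Finite ∧ B ⊆ A ∧ {s : S | (fun a => a + s) '' B ⊆ F}.Finite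

/-- Right addition is finite-to-one: each map `a ↦ a + s` has finite fibres. -/
def FiniteToOneRightAdd (S : Type*) [AddSemigroup S] : Prop :=
  ∀ s b : S, {a : S | a + s = b}.Finite

/-- The generators `t, x 0, x 1, …`. -/
inductive SteinbergGen : Type
  | t : SteinbergGen
  | x : ℕ → SteinbergGen

/-- The defining relations `x₀ + t = x₀` and `xᵢ₊₁ + t = xᵢ`, as a relation on the free
semigroup (nonempty words) on the generators. -/
inductive SteinbergRel :
    FreeAddSemigroup SteinbergGen → FreeAddSemigroup SteinbergGen → Prop
  | zero : SteinbergRel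
      (FreeAddSemigroup.of (SteinbergGen.x 0) + FreeAddSemigroup.of SteinbergGen.t)
      (FreeAddSemigroup.of (SteinbergGen.x 0))
  | succ (i : ℕ) : SteinbergRel
      (FreeAddSemigroup.of (SteinbergGen.x (i + 1)) + FreeAddSemigroup.of SteinbergGen.t)
      (FreeAddSemigroup.of (SteinbergGen.x i))

/-- The semigroup `⟨t, x₀, x₁, … : x₀ + t = x₀, xᵢ + t = xᵢ₋₁ (i > 0)⟩`: the quotient of the free
semigroup by the congruence generated by the defining relations. -/
abbrev SteinbergSemigroup : Type := (addConGen SteinbergRel).Quotient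

end IPSet

open Function

namespace IPSet

/-! Partition regularity holds in every semigroup without elements of finite order
(`isPartitionRegular_isProperIP`): Hindman's theorem puts some `FS b` into one part, and
`isProperIP_FS` finds distinct terms inside it. In the given semigroup each element has a unique
normal form, some letters `t` followed by letters `x i`. Normal forms show that multiples are
distinct and that right addition is finite-to-one. Moving fails for the set of all `x i`, as `x i +
n t = x 0` once `n ≥ i`. -/

/-- The positive multiples of an element: `multiple v n` is `(n + 1) v`. -/
def multiple {S : Type*} [AddSemigroup S] (v : S) : ℕ → S
  | 0 => v
  | n + 1 => v + multiple v n

/-! ### Finite sums and proper IP sets in general semigroups -/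

section AddSemigroup

variable {S : Type*} [AddSemigroup S]

theorem multiple_add_multiple (v : S) (m n : ℕ) :
    multiple v m + multiple v n = multiple v (m + n + 1) := by
  induction m with
  | zero => simp [multiple]
  | succ m ih => rw [multiple, add_assoc, ih, ← multiple]; congr 1; omega

theorem map_multiple {T F : Type*} [AddSemigroup T] [FunLike F S T] [AddHomClass F S T] (f : F)
    (v : S) (n : ℕ) : f (multiple v n) = multiple (f v) n := by
  induction n with
  | zero => rfl
  | succ n ih => rw [multiple, map_add, ih, multiple]

theorem FS_subset_of_add_mem {T : Set S} (hT : ∀ x ∈ T, ∀ y ∈ T, x + y ∈ T) {a : Stream' S}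
    (ha : ∀ i, a.get i ∈ T) : Hindman.FS a ⊆ T := by
  intro m hm
  induction hm with
  | head' a => exact ha 0
  | tail' a m _ ih => exact ih fun i => ha (i + 1)
  | cons' a m _ ih => exact hT _ (ha 0) _ (ih fun i => ha (i + 1))

theorem FS_drop_antitone (a : Stream' S) {k l : ℕ} (h : k ≤ l) :
    Hindman.FS (a.drop l) ⊆ Hindman.FS (a.drop k) := by
  obtain ⟨d, rfl⟩ := Nat.exists_eq_add_of_le h
  rw [← Stream'.drop_drop]
  exact Hindman.FS_iter_tail_sub_FS _ _

/-- Keeping track of the starting index `g 0` makes the induction work: the remaining sum only uses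
later terms, so the head can be added in front. -/
theorem FS_subsequence_subset_drop (a : Stream' S) {c : Stream' S} {m : S}
    (hm : m ∈ Hindman.FS c) (g : ℕ → ℕ) (hg : StrictMono g) (hc : ∀ i, c.get i = a.get (g i)) :
    m ∈ Hindman.FS (a.drop (g 0)) := by
  induction hm generalizing g with
  | head' c =>
    have h : c.head = (a.drop (g 0)).head := by rw [Stream'.head_drop]; exact hc 0
    rw [h]
    exact Hindman.FS.head _
  | tail' c m _ ih =>
    exact FS_drop_antitone a (hg (Nat.lt_succ_self 0)).le
      (ih (fun i => g (i + 1)) (fun i j h => hg (Nat.succ_lt_succ h)) fun i => hc (i + 1))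
  | cons' c m _ ih =>
    have h : c.head = (a.drop (g 0)).head := by rw [Stream'.head_drop]; exact hc 0
    rw [h]
    refine Hindman.FS.cons _ _ ?_
    rw [Stream'.tail_eq_drop, Stream'.drop_drop]
    exact FS_drop_antitone a (hg (Nat.lt_succ_self 0))
      (ih (fun i => g (i + 1)) (fun i j h => hg (Nat.succ_lt_succ h)) fun i => hc (i + 1))

theorem FS_subsequence_subset (a : Stream' S) {g : ℕ → ℕ} (hg : StrictMono g) :
    Hindman.FS (fun i => a.get (g i) : Stream' S) ⊆ Hindman.FS a := fun _ hm =>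
  Hindman.FS_iter_tail_sub_FS a _ (FS_subsequence_subset_drop a hm g hg fun _ => rfl)

theorem multiple_mem_FS_const (v : S) (n : ℕ) :
    multiple v n ∈ Hindman.FS (Stream'.const v) := by
  induction n with
  | zero => exact Hindman.FS.head (Stream'.const v)
  | succ n ih => exact Hindman.FS.cons (Stream'.const v) _ ih

theorem exists_strictMono_injective_comp {α : Type*} (f : ℕ → α) (hf : (Set.range f).Infinite) :
    ∃ g : ℕ → ℕ, StrictMono g ∧ Injective (f ∘ g) := by
  obtain ⟨s, -, hs⟩ := (Set.surjOn_image f Set.univ).exists_bijOn_subset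
  rw [Set.image_univ] at hs
  have hsi : s.Infinite := fun h => hf (hs.image_eq ▸ h.image f)
  refine ⟨Nat.nth (· ∈ s), Nat.nth_strictMono hsi, fun i j h => ?_⟩
  exact Nat.nth_injective hsi
    (hs.injOn (Nat.nth_mem_of_infinite hsi i) (Nat.nth_mem_of_infinite hsi j) h)

/-- In a semigroup without elements of finite order, each set of finite sums is proper IP. -/
theorem isProperIP_FS (hS : ∀ v : S, Injective (multiple v)) (b : Stream' S) :
    IsProperIP (Hindman.FS b) := by
  by_cases hb : (Set.range b.get).Infinite
  · obtain ⟨g, hg, hinj⟩ := exists_strictMono_injective_comp _ hb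
    exact ⟨fun i => b.get (g i), hinj, FS_subsequence_subset b hg⟩
  · have : Finite (Set.range b.get) := Set.not_infinite.1 hb
    obtain ⟨⟨v, hv⟩, hinf⟩ := Finite.exists_infinite_fiber (Set.rangeFactorization b.get)
    have hs : {n | b.get n = v}.Infinite := by
      rw [← Set.infinite_coe_iff]
      convert hinf using 3
      ext n
      simp [Set.rangeFactorization, Subtype.ext_iff]
    have hconst : Hindman.FS (Stream'.const v) ⊆ Hindman.FS b := by
      have h : Stream'.const v = fun i => b.get (Nat.nth (fun n => b.get n = v) i) :=
        funext fun i => (Nat.nth_mem_of_infinite hs i).symm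
      rw [h]
      exact FS_subsequence_subset b (Nat.nth_strictMono hs)
    -- A value `v` recurs infinitely often. Sums of its distinct multiples are multiples of `v`,
    -- hence sums of the constant subsequence.
    refine ⟨multiple v, hS v, (FS_subset_of_add_mem (T := Set.range (multiple v)) ?_
      fun i => ⟨i, rfl⟩).trans
      ((Set.range_subset_iff.2 (multiple_mem_FS_const v)).trans hconst)⟩
    rintro _ ⟨m, rfl⟩ _ ⟨n, rfl⟩
    exact ⟨_, (multiple_add_multiple v m n).symm⟩

/-- In a semigroup without elements of finite order, the proper IP sets are partition regular. -/
theorem isPartitionRegular_isProperIP (hS : ∀ v : S, Injective (multiple v)) :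
    IsPartitionRegular {A : Set S | IsProperIP A} := by
  rintro A ⟨a, -, ha⟩ k P - rfl
  obtain ⟨_, ⟨i, rfl⟩, b, hb⟩ :=
    Hindman.FS_partition_regular a (Set.range P) (Set.finite_range P) (by rwa [Set.sUnion_range])
  obtain ⟨c, hc, hcb⟩ := isProperIP_FS hS b
  exact ⟨i, c, hc, hcb.trans hb⟩

end AddSemigroup

/-! ### The semigroup of normal forms -/

/-- Normal forms of the elements of `SteinbergSemigroup` (and an identity): `⟨n, w⟩` stands for
`n` letters `t` followed by the letters `x i`, with the indices `i` listed in `w` from right to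
left. -/
@[ext]
structure SteinbergNormalForm : Type where
  /-- The number of leading letters `t`. -/
  tCount : ℕ
  /-- The indices of the letters `x`, from right to left. -/
  word : List ℕ

namespace SteinbergNormalForm

/-- Concatenation followed by reduction. -/
def add : SteinbergNormalForm → SteinbergNormalForm → SteinbergNormalForm
  | ⟨n, []⟩, ⟨m, v⟩ => ⟨n + m, v⟩
  -- The head `c` is the rightmost letter, which absorbs the `m` letters `t`; truncated subtraction
  -- encodes `x₀ + t = x₀`.
  | ⟨n, c :: w⟩, ⟨m, v⟩ => ⟨n, v ++ (c - m) :: w⟩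

instance : Add SteinbergNormalForm := ⟨add⟩

@[simp] theorem nil_add (n m : ℕ) (v : List ℕ) :
    (⟨n, []⟩ + ⟨m, v⟩ : SteinbergNormalForm) = ⟨n + m, v⟩ := rfl

@[simp] theorem cons_add (n c m : ℕ) (w v : List ℕ) :
    (⟨n, c :: w⟩ + ⟨m, v⟩ : SteinbergNormalForm) = ⟨n, v ++ (c - m) :: w⟩ := rfl

instance : AddSemigroup SteinbergNormalForm where
  add_assoc := by
    rintro ⟨n, _ | ⟨c, w⟩⟩ ⟨m, _ | ⟨d, v⟩⟩ ⟨k, u⟩ <;> simp [Nat.add_assoc, Nat.sub_sub]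

theorem multiple_nil (n k : ℕ) :
    multiple (⟨n, []⟩ : SteinbergNormalForm) k = ⟨(k + 1) * n, []⟩ := by
  induction k with
  | zero => simp [multiple]
  | succ k ih => rw [multiple, ih, nil_add]; congr 1; ring

theorem length_word_multiple (a : SteinbergNormalForm) (k : ℕ) :
    (multiple a k).word.length = (k + 1) * a.word.length := by
  induction k with
  | zero => simp [multiple]
  | succ k ih =>
    have hadd (a b : SteinbergNormalForm) :
        (a + b).word.length = a.word.length + b.word.length := by
      obtain ⟨n, _ | ⟨c, w⟩⟩ := a <;> obtain ⟨m, v⟩ := b <;> simp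
      omega
    rw [multiple, hadd, ih]
    ring

/-- The number of letters `t` grows if the word is empty, the word length otherwise. -/
theorem multiple_injective {a : SteinbergNormalForm} (ha : a ≠ ⟨0, []⟩) :
    Injective (multiple a) := by
  intro i j h
  obtain ⟨n, _ | ⟨c, w⟩⟩ := a
  · have hn : n ≠ 0 := fun h => ha (by rw [h])
    simpa [multiple_nil, hn] using h
  · have h' := congrArg (fun b => b.word.length) h
    simpa [length_word_multiple] using h'

theorem finite_setOf_add_eq (s b : SteinbergNormalForm) : {a | a + s = b}.Finite := by
  obtain ⟨m, v⟩ := s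
  obtain ⟨k, u⟩ := b
  -- If `a` has word `c :: w`, then `d = (c - m) :: w`, which fixes `w` and bounds `c` by `d.headI +
  -- m`.
  set d := u.drop v.length with hd
  refine (((Set.finite_Iic k).prod (((Set.finite_Iic (d.headI + m)).image
    fun c => c :: d.tail).insert [])).image fun p => mk p.1 p.2).subset ?_
  rintro ⟨n, _ | ⟨c, w⟩⟩ h
  · simp only [Set.mem_ofPred_eq, nil_add, mk.injEq] at h
    exact ⟨(n, []), ⟨Set.mem_Iic.2 (by omega), Set.mem_insert _ _⟩, rfl⟩
  · simp only [Set.mem_ofPred_eq, cons_add, mk.injEq] at h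
    obtain ⟨rfl, rfl⟩ := h
    rw [List.drop_left] at hd
    refine ⟨(n, c :: w), ⟨Set.mem_Iic.2 le_rfl, Set.mem_insert_of_mem _ ⟨c, ?_, ?_⟩⟩, rfl⟩
    · simp only [hd, List.headI_cons, Set.mem_Iic]
      omega
    · simp [hd]

end SteinbergNormalForm

/-! ### Normal forms in the presented semigroup -/

namespace SteinbergSemigroup

/-- The generator `t`. -/
def t : SteinbergSemigroup := ((FreeAddSemigroup.of SteinbergGen.t : _) : SteinbergSemigroup)

/-- The generators `x i`. -/
def x (i : ℕ) : SteinbergSemigroup :=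
  ((FreeAddSemigroup.of (SteinbergGen.x i) : _) : SteinbergSemigroup)

theorem x_add_t (i : ℕ) : x i + t = x (i - 1) := by
  refine (AddCon.eq _).2 (AddConGen.Rel.of _ _ ?_)
  cases i with
  | zero => exact SteinbergRel.zero
  | succ i => exact SteinbergRel.succ i

/-- The normal forms of the generators. -/
def genNormalForm : SteinbergGen → SteinbergNormalForm
  | .t => ⟨1, []⟩
  | .x i => ⟨0, [i]⟩

/-- The normal form of an element. -/
def normalForm : SteinbergSemigroup →ₙ+ SteinbergNormalForm where
  toFun s := AddCon.liftOn s (FreeAddSemigroup.lift genNormalForm) fun a b h => by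
    have hle : addConGen SteinbergRel ≤ AddCon.ker (FreeAddSemigroup.lift genNormalForm) :=
      AddCon.addConGen_le.2 fun a b h => by cases h <;> rfl
    exact hle h
  map_add' a b := by
    induction a, b using AddCon.induction_on₂ with
    | _ a b => exact map_add (FreeAddSemigroup.lift genNormalForm) a b

@[simp] theorem normalForm_t : normalForm t = ⟨1, []⟩ := rfl

@[simp] theorem normalForm_x (i : ℕ) : normalForm (x i) = ⟨0, [i]⟩ := rfl

/-- The sum of the letters `x i`, with indices listed from right to left. -/
def sumX : List ℕ → WithZero SteinbergSemigroup
  | [] => 0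
  | c :: w => sumX w + x c

theorem sumX_append (v w : List ℕ) : sumX (v ++ w) = sumX w + sumX v := by
  induction v with
  | nil => simp [sumX]
  | cons c v ih => simp [sumX, ih, add_assoc]

/-- The element with a given normal form. -/
def ofNormalForm (a : SteinbergNormalForm) : WithZero SteinbergSemigroup :=
  a.tCount • (t : WithZero SteinbergSemigroup) + sumX a.word

theorem coe_x_add_nsmul_t (i n : ℕ) :
    (x i : WithZero SteinbergSemigroup) + n • (t : WithZero SteinbergSemigroup) =
      x (i - n) := by
  induction n with
  | zero => simp
  | succ n ih => rw [succ_nsmul, ← add_assoc, ih, ← WithZero.coe_add, x_add_t, Nat.sub_sub]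

theorem ofNormalForm_add (a b : SteinbergNormalForm) :
    ofNormalForm (a + b) = ofNormalForm a + ofNormalForm b := by
  obtain ⟨n, _ | ⟨c, w⟩⟩ := a <;> obtain ⟨m, v⟩ := b
  · simp [ofNormalForm, sumX, add_nsmul, add_assoc]
  · simp only [SteinbergNormalForm.cons_add, ofNormalForm, sumX_append, sumX,
      ← coe_x_add_nsmul_t, add_assoc]

/-- Both sides are additive, so generators suffice. The identity adjoined by `WithZero` is the value
of the empty normal form. -/
theorem ofNormalForm_normalForm (s : SteinbergSemigroup) : ofNormalForm (normalForm s) = s := by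
  induction s using AddCon.induction_on with
  | _ a =>
    induction a with
    | ih1 g =>
      cases g with
      | t => exact show ofNormalForm ⟨1, []⟩ = t by simp [ofNormalForm, sumX]
      | x i => exact show ofNormalForm ⟨0, [i]⟩ = x i by simp [ofNormalForm, sumX]
    | ih2 g a h₁ h₂ => rw [AddCon.coe_add, map_add, ofNormalForm_add, h₁, h₂, WithZero.coe_add]

theorem normalForm_injective : Injective normalForm := fun a b h =>
  WithZero.coe_injective (by rw [← ofNormalForm_normalForm, h, ofNormalForm_normalForm])

theorem normalForm_ne_zero (s : SteinbergSemigroup) : normalForm s ≠ ⟨0, []⟩ := fun h =>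
  WithZero.coe_ne_zero (a := s) (by rw [← ofNormalForm_normalForm, h]; simp [ofNormalForm, sumX])

theorem multiple_injective (s : SteinbergSemigroup) : Injective (multiple s) := by
  have h := SteinbergNormalForm.multiple_injective (normalForm_ne_zero s)
  intro i j hij
  exact h (by rw [← map_multiple, hij, map_multiple])

theorem x_injective : Injective x := fun i j h => by simpa using congrArg normalForm h

theorem x_add_multiple_t (i n : ℕ) : x i + multiple t n = x (i - (n + 1)) :=
  normalForm_injective (by
    rw [map_add, map_multiple, normalForm_t, SteinbergNormalForm.multiple_nil]
    simp)

theorem finiteToOneRightAdd : FiniteToOneRightAdd SteinbergSemigroup := fun s b =>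
  ((SteinbergNormalForm.finite_setOf_add_eq (normalForm s) (normalForm b)).preimage
    normalForm_injective.injOn).subset fun a h => by
      simpa only [Set.mem_preimage, Set.mem_ofPred_eq, ← map_add] using congrArg normalForm h

theorem not_isMoving : ¬ IsMoving SteinbergSemigroup := by
  rintro ⟨-, h⟩
  obtain ⟨B, hB, hBx, hfin⟩ := h _ (Set.infinite_range_of_injective x_injective) {x 0}
    (Set.finite_singleton _)
  -- The indices in the finite set `B` are at most `N`, so each of the infinitely many elements `(n
  -- + N + 1) t` sends all of `B` to `x 0`.
  obtain ⟨N, hN⟩ := (hB.preimage x_injective.injOn).bddAbove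
  refine (Set.infinite_range_of_injective
    ((multiple_injective t).comp (add_left_injective N))) (hfin.subset ?_)
  rintro _ ⟨n, rfl⟩ _ ⟨b, hb, rfl⟩
  obtain ⟨i, rfl⟩ := hBx hb
  have hi : i ≤ N := hN hb
  simp only [comp_apply, x_add_multiple_t, Set.mem_singleton_iff]
  congr 1
  omega

end SteinbergSemigroup

end IPSet

theorem mainTheorem3 :
    Infinite IPSet.SteinbergSemigroup ∧
    IPSet.FiniteToOneRightAdd IPSet.SteinbergSemigroup ∧
    ¬ IPSet.IsMoving IPSet.SteinbergSemigroup ∧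
    IPSet.IsPartitionRegular {A : Set IPSet.SteinbergSemigroup | IPSet.IsProperIP A} := by
  exact ⟨Infinite.of_injective _ IPSet.SteinbergSemigroup.x_injective,
    IPSet.SteinbergSemigroup.finiteToOneRightAdd, IPSet.SteinbergSemigroup.not_isMoving,
    IPSet.isPartitionRegular_isProperIP IPSet.SteinbergSemigroup.multiple_injective⟩
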